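/- Let $B_m$ be the Bernoulli numbers, $\frac{t}{e^t-1}=\sum_{m\ge 0}B_m\frac{t^m}{m!}$ (so $B_1=-\tfrac12$), let $\left[{k\atop m}\right]$ be the unsigned Stirling numbers of the first kind, let $J_k(n)=\sum_{d\mid n}\mu(n/d)\,d^k$ be Jordan's totient function, and let $\varphi=J_1$ be Euler's totient function. For $k\ge 1$ define polynomials over $\mathbb{Q}$ by $$s_k(x_1,\dots,x_k)=\frac{2(-1)^{k-1}}{(k-1)!}\sum_{m=1}^{k}B_m\left[{k\atop m}\right]x_m,$$ $$F_k(x_1,\dots,x_k)=k!\sum_{\substack{\lambda_1,\dots,\lambda_k\ge 0\\ \lambda_1+2\lambda_2+\cdots+k\lambda_k=k}}\ \prod_{j=1}^{k}\frac{(-s_j(x_1,\dots,x_j))^{\lambda_j}}{\lambda_j!\,j^{\lambda_j}}.$$ **Theorem.** For all integers $n\ge 3$ and $1\le k<\varphi(n)$, the one-variable polynomial $$F_{k,n}(x)=F_k\left(x,\frac{J_2(n)}{4},\frac{J_3(n)}{6},\dots,\frac{J_k(n)}{2k}\right)\in\mathbb{Q}[x]$$ (the value $J_j(n)/(2j)$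 is substituted for $x_j$, $2\le j\le k$) has integer coefficients, i.e. $F_{k,n}(x)\in\mathbb{Z}[x]$. -/

import Mathlib

namespace LehmerPoly

/-- Jordan's totient function `J_k(n) = ∑_{d ∣ n} μ(n/d) d^k`. -/
def jordanTotient (k n : ℕ) : ℤ :=
  ∑ d ∈ n.divisors, ArithmeticFunction.moebius (n / d) * (d : ℤ) ^ k

/-- The polynomial `s_k(x_1, …, x_k) = (2 (-1)^(k-1) / (k-1)!) ∑_{m=1}^k B_m [k, m] x_m` for `k ≥ 1`.
The variable `x_m` is `MvPolynomial.X m`; `bernoulli` has `B_1 = -1/2`, and `[k, m]` is the unsigned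
Stirling number of the first kind. -/
noncomputable def lehmerS (k : ℕ) : MvPolynomial ℕ ℚ :=
  MvPolynomial.C (2 * (-1) ^ (k - 1) / ((k - 1).factorial : ℚ)) *
    ∑ m ∈ Finset.Icc 1 k,
      MvPolynomial.C (bernoulli m * (Nat.stirlingFirst k m : ℚ)) * MvPolynomial.X m

/-- The tuples `(λ_1, …, λ_k)` of natural numbers with `λ_1 + 2 λ_2 + ⋯ + k λ_k = k`. The entry
`λ_j` is `l i` with `j = i + 1`. The bound `λ_j ≤ k` built into the definition is automatic. -/
def weightedTuples (k : ℕ) : Finset (Fin k → ℕ) :=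
  (Fintype.piFinset fun _ : Fin k => Finset.range (k + 1)).filter
    fun l => ∑ i : Fin k, ((i : ℕ) + 1) * l i = k

theorem mem_weightedTuples {k : ℕ} {l : Fin k → ℕ} :
    l ∈ weightedTuples k ↔ ∑ i : Fin k, ((i : ℕ) + 1) * l i = k := by
  simp only [weightedTuples, Finset.mem_filter, Fintype.mem_piFinset, Finset.mem_range,
    and_iff_right_iff_imp]
  intro h i
  have h1 : ((i : ℕ) + 1) * l i ≤ ∑ i : Fin k, ((i : ℕ) + 1) * l i :=
    Finset.single_le_sum (f := fun i : Fin k => ((i : ℕ) + 1) * l i)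
      (fun _ _ => Nat.zero_le _) (Finset.mem_univ i)
  have h2 : l i ≤ ((i : ℕ) + 1) * l i := Nat.le_mul_of_pos_left _ (Nat.succ_pos _)
  omega

/-- The polynomial
`F_k(x_1, …, x_k) = k! ∑_{λ_1 + 2 λ_2 + ⋯ + k λ_k = k} ∏_{j=1}^k (-s_j)^{λ_j} / (λ_j! j^{λ_j})`. -/
noncomputable def lehmerF (k : ℕ) : MvPolynomial ℕ ℚ :=
  MvPolynomial.C (k.factorial : ℚ) *
    ∑ l ∈ weightedTuples k, ∏ i : Fin k,
      (MvPolynomial.C (1 / (((l i).factorial : ℚ) * (((i : ℕ) + 1 : ℕ) : ℚ) ^ l i)) *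
        (-lehmerS ((i : ℕ) + 1)) ^ l i)

/-- The one-variable polynomial `F_{k,n}(x) = F_k(x, J_2(n)/4, …, J_k(n)/(2k))`: the variable `x_1`
is replaced by `x`, and `x_j` by the constant `J_j(n)/(2j)` for `j ≥ 2`. -/
noncomputable def lehmerFOne (k n : ℕ) : Polynomial ℚ :=
  MvPolynomial.aeval
    (fun j : ℕ => if j = 1 then Polynomial.X
      else Polynomial.C ((jordanTotient j n : ℚ) / (2 * (j : ℚ)))) (lehmerF k)

end LehmerPoly

/-!
The key is the generating function
`∑_k F_{k,n}(x) t^k / k! = (1 + t)^(x - φ(n)/2) Φ_n(1 + t) / Φ_n(1)`.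

The sum over weighted tuples defining `F_k` makes the left side `exp(-∑_j s_j t^j / j)`
(`LehmerPoly.sum_weightedTuples_eq_coeff`). The Stirling numbers are the coefficients of the powers
of `L = log(1 + t)` (`PowerSeries.coeff_log_pow`), so the exponent is
`∑_m 2 (-1)^m B_m x_m L^m / m!`. On the other side, Möbius inversion of `y^n - 1 = ∏_{d ∣ n} Φ_d(y)`
at `y = e^L` expresses the logarithmic derivative of `Φ_n` through the Bernoulli numbers and the
Jordan totients (`LehmerPoly.log_mul_derivative_cyclotomic`). Both sides therefore satisfy the same
first-order linear differential equation with the same constant term. This is carried out at the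
points `x = φ(n)/2 + N` with `N` a natural number, where the right side is a polynomial in `t`
(`LehmerPoly.eval_lehmerFOne_eq_coeff`); infinitely many points determine `F_{k,n}`.

Integrality follows since `φ(n)/2` is an integer and, for `i < φ(n)`, the number `Φ_n(1)` divides
the `i`-th coefficient of `Φ_n(1 + t)`: either `Φ_n(1) = 1`, or `n` is a power of a prime and
`Φ_n(1 + t)` is an Eisenstein polynomial (`Polynomial.eval_one_cyclotomic_dvd_coeff_comp`).
-/

/-! ### Logarithm, exponential and Stirling numbers -/

open PowerSeries in
/-- Coefficientwise uniqueness for linear first-order equations: the coefficients up to `k` of a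
solution of `f' = u f` depend only on `f(0)` and on the coefficients of `u` below `k`. -/
theorem PowerSeries.coeff_eq_of_derivative_eq_mul {f g u v : ℚ⟦X⟧} {k : ℕ}
    (hf : d⁄dX ℚ f = u * f) (hg : d⁄dX ℚ g = v * g)
    (h0 : constantCoeff f = constantCoeff g) (huv : ∀ i < k, coeff i u = coeff i v) :
    ∀ i ≤ k, coeff i f = coeff i g := by
  intro i
  induction i using Nat.strong_induction_on with
  | _ i ih =>
    intro hi
    rcases i with _ | i
    · simpa using h0
    · have h : coeff i (u * f) = coeff i (v * g) := by
        rw [coeff_mul, coeff_mul]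
        refine Finset.sum_congr rfl fun p hp => ?_
        have hp' := Finset.HasAntidiagonal.mem_antidiagonal.mp hp
        rw [huv p.1 (by omega), ih p.2 (by omega) (by omega)]
      rw [← hf, ← hg, coeff_derivative, coeff_derivative] at h
      exact mul_right_cancel₀ (by positivity) h

open PowerSeries in
theorem PowerSeries.one_add_X_mul_derivative_log : (1 + X) * d⁄dX ℚ (log ℚ) = 1 := by
  rw [deriv_log]
  ext n
  rcases n with _ | n
  · simp
  · simp [add_mul, coeff_succ_X_mul, coeff_one, pow_succ]

open PowerSeries in
/-- The generating function `∑_j (-1)^(j-m) [j, m] t^j / j! = log(1 + t)^m / m!` of the Stirling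
numbers of the first kind. -/
theorem PowerSeries.coeff_log_pow (j m : ℕ) :
    coeff j (log ℚ ^ m) =
      m.factorial * (-1) ^ (j + m) * Nat.stirlingFirst j m / j.factorial := by
  induction j generalizing m with
  | zero => rcases m with _ | m <;> simp
  | succ j ih =>
    rcases m with _ | m
    · simp [coeff_one]
    · have hd : (1 + X) * d⁄dX ℚ (log ℚ ^ (m + 1)) = ((m : ℚ) + 1) • log ℚ ^ m := by
        rw [derivative_pow, Nat.add_sub_cancel, mul_left_comm, one_add_X_mul_derivative_log,
          mul_one, smul_eq_C_mul]
        simp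
      have hc : ((j : ℚ) + 1) * coeff (j + 1) (log ℚ ^ (m + 1)) + j * coeff j (log ℚ ^ (m + 1))
          = (m + 1) * coeff j (log ℚ ^ m) := by
        have := congrArg (coeff j) hd
        rw [add_mul, one_mul, map_add, coeff_derivative, coeff_smul, smul_eq_mul] at this
        rw [← this]
        rcases j with _ | j
        · simp
        · rw [coeff_succ_X_mul, coeff_derivative]
          push_cast
          ring
      rw [ih, ih] at hc
      have hj : ((j : ℚ) + 1) ≠ 0 := by positivity
      apply mul_left_cancel₀ hj
      rw [eq_sub_of_add_eq hc, Nat.stirlingFirst_succ_succ, Nat.factorial_succ, Nat.factorial_succ]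
      push_cast
      field_simp
      ring

open PowerSeries in
theorem PowerSeries.exp_subst_log : (exp ℚ).subst (log ℚ) = (1 + X : ℚ⟦X⟧) := by
  have hf : d⁄dX ℚ ((exp ℚ).subst (log ℚ)) = d⁄dX ℚ (log ℚ) * (exp ℚ).subst (log ℚ) := by
    rw [derivative_subst HasSubst.log, derivative_exp, mul_comm]
  have hg : d⁄dX ℚ (1 + X : ℚ⟦X⟧) = d⁄dX ℚ (log ℚ) * (1 + X) := by
    rw [mul_comm, one_add_X_mul_derivative_log]
    simp
  have h0 : constantCoeff ((exp ℚ).subst (log ℚ)) = constantCoeff (1 + X : ℚ⟦X⟧) := by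
    rw [← coeff_zero_eq_constantCoeff_apply, coeff_subst' HasSubst.log, finsum_eq_single _ 0]
    · simp
    · intro n hn
      simp [hn]
  ext n
  exact coeff_eq_of_derivative_eq_mul hf hg h0 (k := n) (fun _ _ => rfl) n le_rfl

/-! ### Exponentials and sums over weighted tuples -/

open PowerSeries in
theorem PowerSeries.coeff_exp_subst_C_mul_X_pow (a : ℚ) {j : ℕ} (hj : j ≠ 0) (m : ℕ) :
    coeff m ((exp ℚ).subst (C a * X ^ j : ℚ⟦X⟧)) =
      if j ∣ m then a ^ (m / j) / (m / j).factorial else 0 := by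
  have hs : HasSubst (C a * X ^ j : ℚ⟦X⟧) :=
    HasSubst.of_constantCoeff_zero' (by simp [hj])
  rw [coeff_subst' hs]
  have hc : ∀ d, coeff m ((C a * X ^ j : ℚ⟦X⟧) ^ d) = if m = j * d then a ^ d else 0 := by
    intro d
    rw [mul_pow, ← map_pow, coeff_C_mul, ← pow_mul, coeff_X_pow]
    simp
  simp only [hc]
  split_ifs with h
  · obtain ⟨d, rfl⟩ := h
    rw [finsum_eq_single _ d]
    · rw [Nat.mul_div_cancel_left _ (Nat.pos_of_ne_zero hj)]
      simp
      ring
    · intro d' hd'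
      rw [if_neg, smul_zero]
      intro h
      exact hd' (Nat.eq_of_mul_eq_mul_left (Nat.pos_of_ne_zero hj) h).symm
  · refine finsum_eq_zero_of_forall_eq_zero fun d => ?_
    rw [if_neg, smul_zero]
    rintro rfl
    exact h (Dvd.intro d rfl)

open PowerSeries in
/-- The sum over weighted tuples is the `k`-th coefficient of `∏_{j=1}^k exp(a_j t^j)`. -/
theorem LehmerPoly.coeff_prod_exp_eq_sum_weightedTuples (k : ℕ) (a : Fin k → ℚ) :
    coeff k (∏ i : Fin k, (exp ℚ).subst (C (a i) * X ^ ((i : ℕ) + 1) : ℚ⟦X⟧)) =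
      ∑ l ∈ weightedTuples k, ∏ i : Fin k, a i ^ l i / (l i).factorial := by
  rw [coeff_prod]
  symm
  refine Finset.sum_of_injOn
    (fun l => Finsupp.equivFunOnFinite.symm fun i : Fin k => ((i : ℕ) + 1) * l i) ?_ ?_ ?_ ?_
  · intro l _ l' _ h
    funext i
    have := DFunLike.congr_fun h i
    simpa using this
  · intro l hl
    have := mem_weightedTuples.mp hl
    simpa using this
  · intro l hl hl'
    by_contra hne
    have hdvd : ∀ i : Fin k, ((i : ℕ) + 1) ∣ l i := by
      intro i
      have := Finset.prod_ne_zero_iff.mp hne i (Finset.mem_univ i)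
      rw [coeff_exp_subst_C_mul_X_pow _ (Nat.succ_ne_zero _)] at this
      by_contra h
      exact this (if_neg h)
    choose l' hl'' using hdvd
    refine hl' ⟨l', ?_, ?_⟩
    · rw [Finset.mem_coe, mem_weightedTuples]
      simp only [← hl'']
      simpa using hl
    · ext i
      simp [hl'']
  · intro l _
    refine Finset.prod_congr rfl fun i _ => ?_
    rw [coeff_exp_subst_C_mul_X_pow _ (Nat.succ_ne_zero _)]
    simp

open PowerSeries in
/-- If `f' = h f` with `f(0) = 1`, that is `f = exp(∑_j u_j t^j / j)` where `h = ∑_j u_j t^(j-1)`,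
then the `k`-th coefficient of `f` is the sum over weighted tuples formed from the `u_j`. Only the
`u_j` with `j ≤ k` matter, so `f` may be compared with a finite product of exponentials. -/
theorem LehmerPoly.sum_weightedTuples_eq_coeff {k : ℕ} {u : ℕ → ℚ} {f h : ℚ⟦X⟧}
    (hf : d⁄dX ℚ f = h * f) (h0 : constantCoeff f = 1) (hh : ∀ i < k, coeff i h = u (i + 1)) :
    ∑ l ∈ weightedTuples k, ∏ i : Fin k,
      (1 / (((l i).factorial : ℚ) * (((i : ℕ) + 1 : ℕ) : ℚ) ^ l i)) * u ((i : ℕ) + 1) ^ l i =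
      coeff k f := by
  set E : Fin k → ℚ⟦X⟧ := fun i =>
    (exp ℚ).subst (C (u ((i : ℕ) + 1) / ((i : ℕ) + 1 : ℕ)) * X ^ ((i : ℕ) + 1) : ℚ⟦X⟧) with hE
  have hs : ∀ (a : ℚ) (i : ℕ), HasSubst (C a * X ^ (i + 1) : ℚ⟦X⟧) := fun a i =>
    HasSubst.of_constantCoeff_zero' (by simp)
  have hEd : ∀ i, d⁄dX ℚ (E i) = E i * (C (u ((i : ℕ) + 1)) * X ^ (i : ℕ)) := by
    intro i
    rw [hE, derivative_subst (hs _ _), derivative_exp]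
    congr 1
    ext m
    have : ((i : ℕ) : ℚ) + 1 ≠ 0 := by positivity
    rw [coeff_derivative, coeff_C_mul, coeff_C_mul, coeff_X_pow, coeff_X_pow]
    by_cases hm : m = i
    · subst hm
      simp
      field_simp
    · simp [hm]
  have hEd' (s : Finset (Fin k)) : d⁄dX ℚ (∏ i ∈ s, E i) =
      (∑ i ∈ s, C (u ((i : ℕ) + 1)) * X ^ (i : ℕ)) * ∏ i ∈ s, E i := by
    induction s using Finset.induction_on with
    | empty => simp
    | insert i s hi ih =>
      rw [Finset.prod_insert hi, Finset.sum_insert hi, Derivation.leibniz, ih, hEd, smul_eq_mul,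
        smul_eq_mul]
      ring
  have hE0 : constantCoeff (∏ i, E i) = 1 := by
    rw [map_prod]
    refine Finset.prod_eq_one fun i _ => ?_
    rw [← coeff_zero_eq_constantCoeff_apply, hE, coeff_exp_subst_C_mul_X_pow _ (Nat.succ_ne_zero _)]
    simp
  rw [coeff_eq_of_derivative_eq_mul hf (hEd' Finset.univ) (h0.trans hE0.symm) _ k le_rfl,
    hE, coeff_prod_exp_eq_sum_weightedTuples]
  · refine Finset.sum_congr rfl fun l _ => Finset.prod_congr rfl fun i _ => ?_
    rw [div_pow, div_div, mul_comm, mul_one_div, mul_comm (_ ^ _)]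
  · intro i hi
    rw [hh i hi, map_sum, Finset.sum_eq_single (⟨i, hi⟩ : Fin k)]
    · simp
    · intro b _ hb
      rw [coeff_C_mul, coeff_X_pow, if_neg, mul_zero]
      rintro rfl
      exact hb rfl
    · simp

/-! ### Cyclotomic polynomials and Jordan totients -/

open Polynomial in
/-- If `n` is a power of a prime `p`, then `Φ_n(1) = p` and `Φ_n(X + 1)` is Eisenstein at `p`;
otherwise `Φ_n(1) = 1`. -/
theorem Polynomial.eval_one_cyclotomic_dvd_coeff_comp {n i : ℕ} (hn : n ≠ 1) (hi : i < n.totient) :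
    (cyclotomic n ℤ).eval 1 ∣ ((cyclotomic n ℤ).comp (X + 1)).coeff i := by
  by_cases h : ∃ p k : ℕ, p.Prime ∧ p ^ k = n
  · obtain ⟨p, k, hp, rfl⟩ := h
    rcases k with _ | k
    · simp at hn
    · have := Fact.mk hp
      rw [eval_one_cyclotomic_prime_pow]
      have hE := cyclotomic_prime_pow_comp_X_add_one_isEisensteinAt p k
      have hd : i < ((cyclotomic (p ^ (k + 1)) ℤ).comp (X + 1)).natDegree := by
        rw [natDegree_comp, natDegree_cyclotomic, ← C_1, natDegree_X_add_C, mul_one]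
        exact hi
      have := hE.mem hd
      exact Ideal.mem_span_singleton.mp (by simpa using this)
  · push Not at h
    rw [eval_one_cyclotomic_not_prime_pow fun hp k => h _ k hp]
    exact one_dvd _

open Polynomial in
/-- Möbius inversion of the logarithmic derivative of `y^n - 1 = ∏_{d ∣ n} Φ_d(y)`. -/
theorem Polynomial.logDeriv_cyclotomic_eq_sum_moebius {K : Type*} [Field K] {y : K}
    (hy : ∀ d > 0, y ^ d ≠ 1) {n : ℕ} (hn : 0 < n) :
    y * (derivative (cyclotomic n K)).eval y / (cyclotomic n K).eval y =
      ∑ p ∈ n.divisorsAntidiagonal,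
        (ArithmeticFunction.moebius p.1 : K) * (p.2 * y ^ p.2 / (y ^ p.2 - 1)) := by
  refine (((ArithmeticFunction.sum_eq_iff_sum_mul_moebius_eq
    (f := fun d => y * (derivative (cyclotomic d K)).eval y / (cyclotomic d K).eval y)
    (g := fun d => d * y ^ d / (y ^ d - 1))).mp ?_) n hn).symm
  intro m hm
  have hprod := prod_cyclotomic_eq_X_pow_sub_one hm K
  have hev : ∏ d ∈ m.divisors, (cyclotomic d K).eval y = y ^ m - 1 := by
    simpa [eval_prod] using congrArg (eval y) hprod
  have hne : y ^ m - 1 ≠ 0 := sub_ne_zero.mpr (hy m hm)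
  have hder := congrArg (fun q => eval y (derivative q)) hprod
  simp only [derivative_prod_finset, eval_finsetSum, eval_mul, eval_prod, derivative_sub,
    derivative_X_pow, derivative_one, sub_zero, eval_C, eval_pow, eval_X] at hder
  rw [eq_div_iff hne, Finset.sum_mul]
  trans y * (m * y ^ (m - 1))
  · rw [← hder, Finset.mul_sum]
    refine Finset.sum_congr rfl fun d hd => ?_
    rw [← hev, ← Finset.mul_prod_erase _ _ hd]
    have : (cyclotomic d K).eval y ≠ 0 := by
      intro h0
      exact hne (hev ▸ Finset.prod_eq_zero hd h0)
    field_simp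
  · rw [mul_left_comm, mul_pow_sub_one hm.ne']

theorem LehmerPoly.jordanTotient_zero {n : ℕ} (hn : 1 < n) : jordanTotient 0 n = 0 := by
  have h := (ArithmeticFunction.sum_eq_iff_sum_mul_moebius_eq (R := ℤ)
    (f := fun d => if d = 1 then 1 else 0) (g := fun _ => 1)).mp
    (fun m hm => by simp [hm.ne']) n (by omega)
  simp only [Int.cast_id] at h
  rw [Nat.sum_divisorsAntidiagonal' (fun a _ => (ArithmeticFunction.moebius a : ℤ) * 1)] at h
  simpa [jordanTotient, hn.ne'] using h

theorem LehmerPoly.jordanTotient_one {n : ℕ} (hn : 0 < n) : jordanTotient 1 n = n.totient := by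
  have h := (ArithmeticFunction.sum_eq_iff_sum_mul_moebius_eq (R := ℤ)
    (f := fun d => (d.totient : ℤ)) (g := fun d => d)).mp
    (fun m hm => by exact_mod_cast Nat.sum_totient m) n hn
  simp only [Int.cast_id] at h
  rw [Nat.sum_divisorsAntidiagonal' (fun a b => (ArithmeticFunction.moebius a : ℤ) * (b : ℤ))] at h
  simpa [jordanTotient] using h

/-! ### Bernoulli numbers and the logarithmic derivative -/

open PowerSeries in
theorem LehmerPoly.sum_moebius_smul_rescale_bernoulli'PowerSeries (n : ℕ) :
    ∑ p ∈ n.divisorsAntidiagonal,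
      (ArithmeticFunction.moebius p.1 : ℚ) • rescale (p.2 : ℚ) (bernoulli'PowerSeries ℚ) =
      mk fun m => bernoulli' m * jordanTotient m n / m.factorial := by
  ext m
  rw [map_sum, coeff_mk, Nat.sum_divisorsAntidiagonal'
    (fun a b => coeff m ((ArithmeticFunction.moebius a : ℚ) •
      rescale (b : ℚ) (bernoulli'PowerSeries ℚ))), jordanTotient]
  push_cast
  rw [Finset.mul_sum, Finset.sum_div]
  refine Finset.sum_congr rfl fun d _ => ?_
  simp [bernoulli'PowerSeries, coeff_rescale]
  ring

open PowerSeries in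
/-- The identity `(dz / (1 - e^(-dz))) (e^(dz) - 1) = dz e^(dz)` at `z = log(1 + t)`. -/
theorem PowerSeries.subst_log_rescale_bernoulli'PowerSeries (d : ℕ) :
    (rescale (d : ℚ) (bernoulli'PowerSeries ℚ)).subst (log ℚ) * ((1 + X) ^ d - 1) =
      (d : ℚ⟦X⟧) * log ℚ * (1 + X) ^ d := by
  have h := congrArg (fun f => (rescale (d : ℚ) f).subst (log ℚ))
    (bernoulli'PowerSeries_mul_exp_sub_one ℚ)
  simp only [map_mul, map_sub, map_one, ← exp_pow_eq_rescale_exp, rescale_X] at h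
  simp only [← coe_substAlgHom (HasSubst.log (A := ℚ)), map_mul, map_sub, map_one, map_pow] at h ⊢
  rw [coe_substAlgHom, exp_subst_log, ← coe_substAlgHom (HasSubst.log (A := ℚ)),
    substAlgHom_X] at h
  simpa using h

open PowerSeries in
/-- With `y = 1 + t = e^L`, this is `L y Φ_n'(y) / Φ_n(y) = ∑_m (-1)^m B_m J_m(n) L^m / m!`. The
proof takes place in the fraction field of `ℚ⟦X⟧`, because the terms `y^d - 1` are not invertible
power series. -/
theorem LehmerPoly.log_mul_derivative_cyclotomic {n : ℕ} (hn : 0 < n) :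
    log ℚ * ((1 + X) * Polynomial.aeval (1 + X : ℚ⟦X⟧)
        (Polynomial.derivative (Polynomial.cyclotomic n ℚ))) =
      (mk fun m => bernoulli' m * jordanTotient m n / m.factorial : ℚ⟦X⟧).subst (log ℚ) *
        Polynomial.aeval (1 + X : ℚ⟦X⟧) (Polynomial.cyclotomic n ℚ) := by
  let K := FractionRing ℚ⟦X⟧
  let φ : ℚ⟦X⟧ →+* K := algebraMap ℚ⟦X⟧ K
  have hφ : Function.Injective φ := IsFractionRing.injective ℚ⟦X⟧ K
  have hy : ∀ d > 0, (φ (1 + X)) ^ d ≠ 1 := by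
    intro d hd h
    rw [← map_pow, ← map_one φ] at h
    have h1 := congrArg (coeff 1) (hφ h)
    rw [show (1 + X : ℚ⟦X⟧) ^ d = (((1 + Polynomial.X) ^ d : Polynomial ℚ) : ℚ⟦X⟧) by simp,
      Polynomial.coeff_coe, Polynomial.coeff_one_add_X_pow] at h1
    simp [coeff_one] at h1
    omega
  have haev (p : Polynomial ℚ) : φ (Polynomial.aeval (1 + X : ℚ⟦X⟧) p) =
      (p.map (algebraMap ℚ K)).eval (φ (1 + X)) := by
    rw [Polynomial.aeval_def, Polynomial.hom_eval₂, Polynomial.eval_map]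
    rfl
  have hL : φ (log ℚ) ≠ 0 := by
    rw [Ne, map_eq_zero_iff φ hφ]
    intro h
    simpa using congrArg (coeff 1) h
  have hΦ : (Polynomial.cyclotomic n K).eval (φ (1 + X)) ≠ 0 := by
    intro h
    have h2 := Polynomial.eval_dvd (x := φ (1 + X)) (Polynomial.cyclotomic.dvd_X_pow_sub_one n K)
    rw [h, zero_dvd_iff] at h2
    simp only [Polynomial.eval_sub, Polynomial.eval_pow, Polynomial.eval_X,
      Polynomial.eval_one] at h2
    exact hy n hn (sub_eq_zero.mp h2)
  apply hφ
  rw [map_mul, map_mul, map_mul, haev, haev, ← Polynomial.derivative_map,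
    Polynomial.map_cyclotomic, ← sum_moebius_smul_rescale_bernoulli'PowerSeries,
    ← div_eq_iff hΦ, mul_div_assoc, Polynomial.logDeriv_cyclotomic_eq_sum_moebius hy hn,
    ← coe_substAlgHom (HasSubst.log (A := ℚ)), map_sum, map_sum, Finset.mul_sum]
  refine Finset.sum_congr rfl fun p hp => ?_
  have hp2 : 0 < p.2 := Nat.pos_of_ne_zero (Nat.ne_zero_of_mem_divisorsAntidiagonal hp).2
  have hb := congrArg φ (subst_log_rescale_bernoulli'PowerSeries p.2)
  rw [map_mul, map_sub, map_pow, map_mul, map_mul, map_natCast, map_pow, map_one,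
    ← eq_div_iff (sub_ne_zero.mpr (hy _ hp2))] at hb
  rw [map_smul, coe_substAlgHom, smul_eq_C_mul, map_mul, hb]
  simp
  ring

/-! ### The generating function -/

/-- The values substituted for the variables of `F_k`: `x_1 = q`, and `x_m = J_m(n) / (2m)`
for `m ≠ 1`. -/
noncomputable def LehmerPoly.specialValue (n : ℕ) (q : ℚ) (m : ℕ) : ℚ :=
  if m = 1 then q else (jordanTotient m n : ℚ) / (2 * m)

/-- The power series `W(z) = ∑_{m ≥ 1} 2 (-1)^m B_m x_m z^m / m!`, which satisfies
`W(log(1 + t)) = -∑_{j ≥ 1} s_j(x) t^j / j`. The sign `(-1)^m` is absorbed in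
`bernoulli' m = (-1)^m * bernoulli m`. -/
noncomputable def LehmerPoly.bernoulliSeries (x : ℕ → ℚ) : PowerSeries ℚ :=
  PowerSeries.mk fun m => if m = 0 then 0 else 2 * bernoulli' m * x m / m.factorial

open PowerSeries in
theorem LehmerPoly.coeff_derivative_bernoulliSeries_subst_log (x : ℕ → ℚ) (j : ℕ) :
    coeff j (d⁄dX ℚ ((bernoulliSeries x).subst (log ℚ))) =
      -MvPolynomial.eval x (lehmerS (j + 1)) := by
  rw [coeff_derivative, coeff_subst' HasSubst.log,
    finsum_eq_sum_of_support_subset (s := Finset.Icc 1 (j + 1)), lehmerS, Finset.sum_mul]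
  · simp only [map_mul, map_sum, MvPolynomial.eval_C, MvPolynomial.eval_X, Nat.add_sub_cancel]
    rw [Finset.mul_sum, ← Finset.sum_neg_distrib]
    refine Finset.sum_congr rfl fun m hm => ?_
    have hm0 : m ≠ 0 := by
      have := Finset.mem_Icc.mp hm
      omega
    have h1 : ((-1 : ℚ) ^ m) * (-1) ^ m = 1 := by rw [← mul_pow]; simp
    have hj : ((j : ℚ) + 1) ≠ 0 := by positivity
    rw [coeff_log_pow, bernoulliSeries, coeff_mk, if_neg hm0, bernoulli'_eq_bernoulli,
      Nat.factorial_succ, pow_add, pow_succ, smul_eq_mul]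
    push_cast
    field_simp
    linear_combination
      (-(bernoulli m * x m * ((j + 1).stirlingFirst m : ℚ))) * h1
  · intro m hm
    rw [Function.mem_support, bernoulliSeries, coeff_mk, coeff_log_pow] at hm
    rw [Finset.mem_coe, Finset.mem_Icc]
    by_contra hcon
    apply hm
    rcases Nat.eq_zero_or_pos m with h0 | h0
    · simp [h0]
    · rw [Nat.stirlingFirst_eq_zero_of_lt (by omega : j + 1 < m)]
      simp

open PowerSeries in
theorem LehmerPoly.X_mul_derivative_bernoulliSeries {n : ℕ} (hn : 1 < n) (q : ℚ) :
    X * d⁄dX ℚ (bernoulliSeries (specialValue n q)) =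
      (q - (n.totient : ℚ) / 2) • X +
        mk fun m => bernoulli' m * jordanTotient m n / m.factorial := by
  ext m
  rcases m with _ | _ | m
  · simp [jordanTotient_zero hn]
  · simp [coeff_succ_X_mul, coeff_derivative, bernoulliSeries, specialValue,
      jordanTotient_one (Nat.zero_lt_of_lt hn)]
    ring
  · rw [coeff_succ_X_mul, coeff_derivative, bernoulliSeries, coeff_mk, map_add, coeff_smul,
      coeff_X, coeff_mk, specialValue, if_neg (by omega), if_neg (by omega), if_neg (by omega)]
    have : (m : ℚ) + 1 + 1 ≠ 0 := by positivity
    push_cast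
    field_simp
    simp

open PowerSeries in
/-- For `x_1 = φ(n)/2 + N`, the polynomial `(1 + t)^N Φ_n(1 + t)` has logarithmic derivative
`(W(log(1 + t)))'`. -/
theorem LehmerPoly.derivative_cyclotomic_shift {n : ℕ} (hn : 1 < n) (N : ℕ) :
    d⁄dX ℚ ((((Polynomial.X + 1) ^ N * (Polynomial.cyclotomic n ℚ).comp (Polynomial.X + 1) :
        Polynomial ℚ) : ℚ⟦X⟧)) =
      d⁄dX ℚ ((bernoulliSeries (specialValue n ((n.totient : ℚ) / 2 + N))).subst (log ℚ)) *
        (((Polynomial.X + 1) ^ N * (Polynomial.cyclotomic n ℚ).comp (Polynomial.X + 1) :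
          Polynomial ℚ) : ℚ⟦X⟧) := by
  have hL : log ℚ ≠ 0 := by
    intro h
    simpa using congrArg (coeff 1) h
  have hY : (1 + X : ℚ⟦X⟧) ≠ 0 := by
    intro h
    simpa using congrArg (coeff 0) h
  have hcomp (p : Polynomial ℚ) : ((p.comp (Polynomial.X + 1) : Polynomial ℚ) : ℚ⟦X⟧) =
      Polynomial.aeval (1 + X : ℚ⟦X⟧) p := by
    rw [Polynomial.comp, Polynomial.aeval_def, ← Polynomial.coeToPowerSeries.ringHom_apply,
      Polynomial.hom_eval₂]
    congr 1
    · ext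
      simp
    · simp [add_comm]
  have hΦ := log_mul_derivative_cyclotomic (Nat.zero_lt_of_lt hn)
  have hW := congrArg (substAlgHom (HasSubst.log (A := ℚ)))
    (X_mul_derivative_bernoulliSeries hn ((n.totient : ℚ) / 2 + N))
  rw [map_mul, map_add, substAlgHom_X, map_smul, substAlgHom_X, coe_substAlgHom,
    add_sub_cancel_left, smul_eq_C_mul] at hW
  have hlog := one_add_X_mul_derivative_log
  have hF : d⁄dX ℚ (Polynomial.aeval (1 + X : ℚ⟦X⟧) (Polynomial.cyclotomic n ℚ)) =
      Polynomial.aeval (1 + X : ℚ⟦X⟧) (Polynomial.derivative (Polynomial.cyclotomic n ℚ)) := by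
    rw [← hcomp, ← hcomp, derivative_coe, Polynomial.derivative_comp]
    simp
  have hpow : (1 + X) * d⁄dX ℚ ((1 + X : ℚ⟦X⟧) ^ N) = C (N : ℚ) * (1 + X) ^ N := by
    rw [derivative_pow]
    rcases N with _ | N
    · simp
    · simp
      ring
  rw [derivative_subst HasSubst.log, Polynomial.coe_mul, hcomp, Polynomial.coe_pow,
    Polynomial.coe_add, Polynomial.coe_X, Polynomial.coe_one, add_comm X, Derivation.leibniz,
    smul_eq_mul, smul_eq_mul, hF]
  apply mul_left_cancel₀ (mul_ne_zero hL hY)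
  set F := Polynomial.aeval (1 + X : ℚ⟦X⟧) (Polynomial.cyclotomic n ℚ)
  linear_combination log ℚ * F * hpow + (1 + X) ^ N * hΦ - (1 + X) ^ N * F * hW -
    (1 + X) ^ N * F * log ℚ * (d⁄dX ℚ (bernoulliSeries
      (specialValue n ((n.totient : ℚ) / 2 + N)))).subst (log ℚ) * hlog

theorem LehmerPoly.eval_lehmerFOne (k n : ℕ) (q : ℚ) :
    (lehmerFOne k n).eval q = k.factorial *
      ∑ l ∈ weightedTuples k, ∏ i : Fin k,
        (1 / (((l i).factorial : ℚ) * (((i : ℕ) + 1 : ℕ) : ℚ) ^ l i)) *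
          (-MvPolynomial.eval (specialValue n q) (lehmerS ((i : ℕ) + 1))) ^ l i := by
  have h : (lehmerFOne k n).eval q = MvPolynomial.eval (specialValue n q) (lehmerF k) := by
    rw [lehmerFOne, ← Polynomial.coe_aeval_eq_eval, MvPolynomial.comp_aeval_apply,
      MvPolynomial.aeval_eq_eval]
    congr 2
    funext j
    rw [specialValue]
    split_ifs <;> simp
  rw [h, lehmerF]
  simp only [map_mul, map_sum, map_prod, map_pow, map_neg, MvPolynomial.eval_C]

/-- The generating function `∑_k F_{k,n}(φ(n)/2 + N) t^k / k! = (1 + t)^N Φ_n(1 + t) / Φ_n(1)`. -/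
theorem LehmerPoly.eval_lehmerFOne_eq_coeff {n : ℕ} (hn : 2 < n) (k N : ℕ) :
    (lehmerFOne k n).eval ((n.totient : ℚ) / 2 + N) = k.factorial *
      (((Polynomial.X + 1) ^ N * (Polynomial.cyclotomic n ℚ).comp (Polynomial.X + 1)).coeff k /
        (Polynomial.cyclotomic n ℚ).eval 1) := by
  have hv : (Polynomial.cyclotomic n ℚ).eval 1 ≠ 0 :=
    (Polynomial.cyclotomic_pos hn 1).ne'
  have hd := derivative_cyclotomic_shift (by omega : 1 < n) N
  set B : Polynomial ℚ :=
    (Polynomial.X + 1) ^ N * (Polynomial.cyclotomic n ℚ).comp (Polynomial.X + 1) with hB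
  have hB0 : B.coeff 0 = (Polynomial.cyclotomic n ℚ).eval 1 := by
    simp [hB, Polynomial.coeff_zero_eq_eval_zero]
  rw [eval_lehmerFOne]
  congr 1
  rw [sum_weightedTuples_eq_coeff
    (u := fun j => -MvPolynomial.eval (specialValue n ((n.totient : ℚ) / 2 + N)) (lehmerS j))
    (f := ((Polynomial.cyclotomic n ℚ).eval 1)⁻¹ • (B : PowerSeries ℚ)) (h := _)
    (by rw [Derivation.map_smul, hd, mul_smul_comm])
    (by rw [← PowerSeries.coeff_zero_eq_constantCoeff_apply, PowerSeries.coeff_smul,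
          Polynomial.coeff_coe, hB0, smul_eq_mul, inv_mul_cancel₀ hv])
    (fun i _ => coeff_derivative_bernoulliSeries_subst_log _ i)]
  rw [PowerSeries.coeff_smul, Polynomial.coeff_coe, smul_eq_mul, div_eq_inv_mul]

/-! ### Integrality -/

open Polynomial in
theorem theorem4p5 (n k : ℕ) (hn : 3 ≤ n) (hk : 1 ≤ k) (hkn : k < Nat.totient n) :
    ∃ P : Polynomial ℤ, P.map (Int.castRingHom ℚ) = LehmerPoly.lehmerFOne k n := by
  obtain ⟨a, ha⟩ := Nat.totient_even (show 2 < n by omega)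
  have hdvd (i : ℕ) (hi : i < n.totient) :=
    Polynomial.eval_one_cyclotomic_dvd_coeff_comp (show n ≠ 1 by omega) hi
  set v : ℤ := (cyclotomic n ℤ).eval 1 with hv
  set c : ℕ → ℤ := fun i => ((cyclotomic n ℤ).comp (X + 1)).coeff i with hc
  have hvQ : (cyclotomic n ℚ).eval 1 = v := by
    rw [hv, ← map_cyclotomic_int, eval_one_map]
    rfl
  have hcQ (i : ℕ) : ((cyclotomic n ℚ).comp (X + 1)).coeff i = c i := by
    rw [hc, ← map_cyclotomic_int, ← eq_intCast (Int.castRingHom ℚ), ← coeff_map, map_comp]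
    simp
  have hv0 : (v : ℚ) ≠ 0 := by
    rw [← hvQ]
    exact (cyclotomic_pos (by omega) 1).ne'
  -- The `k`-th coefficient of `(1 + t)^(x - a) * Φ_n(1 + t) / Φ_n(1)`, multiplied by `k!`, where
  -- `a = φ(n) / 2`: for `j + i = k`, the `j`-th coefficient of the first factor is a binomial
  -- coefficient of `x - a`, and `k! = j! * k.descFactorial i` clears its denominator `j!`. The
  -- division by `v = Φ_n(1)` is exact.
  refine ⟨∑ p ∈ Finset.HasAntidiagonal.antidiagonal k,
    C (c p.2 / v * k.descFactorial p.2) * (descPochhammer ℤ p.1).comp (X - C (a : ℤ)), ?_⟩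
  refine Polynomial.eq_of_infinite_eval_eq _ _ (Set.Infinite.mono ?_
    (Set.infinite_range_of_injective (f := fun N : ℕ => (n.totient : ℚ) / 2 + N) ?_))
  · rintro _ ⟨N, rfl⟩
    rw [Set.mem_ofPred_eq, LehmerPoly.eval_lehmerFOne_eq_coeff (by omega), coeff_mul, hvQ,
      Polynomial.map_sum, eval_finsetSum, Finset.sum_div, Finset.mul_sum]
    refine Finset.sum_congr rfl fun p hp => ?_
    have hp' := Finset.HasAntidiagonal.mem_antidiagonal.mp hp
    obtain ⟨e, he⟩ := hdvd p.2 (by omega)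
    have hq : (n.totient : ℚ) / 2 + N - a = N := by
      rw [ha]
      push_cast
      ring
    have hce : c p.2 / v = e := by
      rw [show c p.2 = v * e from he, Int.mul_ediv_cancel_left]
      exact_mod_cast hv0
    have hfac : (k.factorial : ℚ) = p.1.factorial * k.descFactorial p.2 := by
      rw [← Nat.factorial_mul_descFactorial (show p.2 ≤ k by omega),
        show k - p.2 = p.1 by omega]
      push_cast
      ring
    rw [coeff_X_add_one_pow, hcQ, hce, show c p.2 = v * e from he, Polynomial.map_mul, eval_mul,
      map_comp, eval_comp, descPochhammer_map]
    simp only [map_C, Polynomial.map_sub, map_X, eval_sub, eval_X, eval_C]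
    rw [eq_intCast, eq_intCast, Int.cast_natCast, hq, descPochhammer_eval_eq_descFactorial,
      Nat.descFactorial_eq_factorial_mul_choose N, hfac]
    push_cast
    field_simp
  · intro x y hxy
    simpa using hxy
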